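/- Let $\mathbb D=\{z\in\mathbb C:|z|<1\}$. Let $\mathcal K$ be the class of convex univalent functions, i.e. of functions $f$ analytic in $\mathbb D$ with $f(0)=0$, $f'(0)=1$, $f'(z)\neq0$ and $\mathrm{Re}\{1+zf''(z)/f'(z)\}>0$ for all $z\in\mathbb D$. For $|\zeta|\le 1$ and $f\in\mathcal K$ put $$ d_\zeta f(z)=\frac1z\left(f(z)*\frac{z}{(1-\zeta z)(1-z)}\right),\qquad z\in\mathbb D, $$ where $*$ is the Hadamard product, $\sum a_nz^n*\sum b_nz^n=\sum a_nb_nz^n$, and the removable singularity at $z=0$ is removed. Then, for all $f\in\mathcal K$, $z\in\mathbb D$ and $|\zeta|\le1$, one has $d_\zeta f(z)\ne0$ and $$ \mathrm{Re}\left\{\frac{\zeta}{1-\zeta}\left(\frac{f'(z)}{\zeta\, d_\zeta f(z)}-1\right)\right\}>\frac12 . $$ Here, for fixed $f$ and $z$, the expression in braces extends continuously in $\zeta$ to the whole closed disc $|\zeta|\le1$, and at $\zeta=0$ and $\zeta=1$ it denotes the values of this extension, which are $f'(z)/d_0f(z)$ and $1+\dfrac{zf''(z)}{2f'(z)}$,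 respectively. The bound is best possible: for every $\zeta$ with $|\zeta|\le1$, the infimum of the left-hand side over all $f\in\mathcal K$ and $z\in\mathbb D$ is $\frac12$. Moreover the function $g(z)=z/(1-z)$ belongs to $\mathcal K$, and for $f=g$ the expression in braces equals $1/(1-z)$, which maps $\mathbb D$ onto the half-plane $\mathrm{Re}\,w>\frac12$. -/

import Mathlib

open Metric Set

noncomputable section

/-- The class `𝒜`: functions analytic in the open unit disc with `f 0 = 0` and `f' 0 = 1`. -/
structure IsNormalizedAnalytic (f : ℂ → ℂ) : Prop where
  differentiableOn : DifferentiableOn ℂ f (ball 0 1)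
  map_zero : f 0 = 0
  deriv_zero : deriv f 0 = 1

/-- The class `𝒦` of convex univalent functions: the functions `f` in `𝒜` with
`Re (1 + z f''(z) / f'(z)) > 0` in the open unit disc. That the quotient makes sense,
i.e. `f' z ≠ 0`, is part of the condition. -/
structure IsConvexUnivalent (f : ℂ → ℂ) : Prop extends IsNormalizedAnalytic f where
  deriv_ne_zero : ∀ z ∈ ball (0 : ℂ) 1, deriv f z ≠ 0
  re_pos : ∀ z ∈ ball (0 : ℂ) 1, 0 < (1 + z * deriv (deriv f) z / deriv f z).re

/-- The `n`-th Taylor coefficient of `f` at the origin. -/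
def taylorCoeffZero (f : ℂ → ℂ) (n : ℕ) : ℂ :=
  iteratedDeriv n f 0 / (n.factorial : ℂ)

/-- The Hadamard product (convolution) `(f ∗ g)(z) = ∑ aₙ bₙ zⁿ` of
`f(z) = ∑ aₙ zⁿ` and `g(z) = ∑ bₙ zⁿ`. -/
def hadamardProduct (f g : ℂ → ℂ) (z : ℂ) : ℂ :=
  ∑' n : ℕ, taylorCoeffZero f n * taylorCoeffZero g n * z ^ n

/-- The function `h_ζ(z) = z / ((1 - ζ z) (1 - z))`. -/
def hZeta (ζ z : ℂ) : ℂ := z / ((1 - ζ * z) * (1 - z))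

/-- The `ζ`-derivative `d_ζ f(z) = (1/z) (f ∗ h_ζ)(z)`. At the origin, where `f ∗ h_ζ` vanishes
(for `f 0 = 0`), it is the value `(f ∗ h_ζ)'(0)` that removes the singularity. -/
def zetaDeriv (ζ : ℂ) (f : ℂ → ℂ) (z : ℂ) : ℂ :=
  if z = 0 then deriv (hadamardProduct f (hZeta ζ)) 0
  else 1 / z * hadamardProduct f (hZeta ζ) z

/-- The expression `ζ / (1 - ζ) * (f'(z) / (ζ d_ζ f(z)) - 1)`. It is literally meaningful for
`ζ ≠ 0, 1` only; at these two values of `ζ` the singularity is removable and the expression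
denotes its limit, `f'(z) / d_0 f(z)` at `ζ = 0` and `1 + z f''(z) / (2 f'(z))` at `ζ = 1`. -/
def zetaExpr (f : ℂ → ℂ) (ζ z : ℂ) : ℂ :=
  if ζ = 0 then deriv f z / zetaDeriv 0 f z
  else if ζ = 1 then 1 + z * deriv (deriv f) z / (2 * deriv f z)
  else ζ / (1 - ζ) * (deriv f z / (ζ * zetaDeriv ζ f z) - 1)

end

noncomputable section

open Complex Filter Topology ComplexConjugate

/-! Fix `z ≠ 0`. Since `d_ζ f(z) = (f z - f (ζ z)) / ((1 - ζ) z)`, the expression equals `z f'(z) /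
(f z - f (ζ z)) - ζ / (1 - ζ)` for `ζ ≠ 0, 1`. If `|ζ| = 1`, the last quotient has real part `-1/2`,
so the bound says that the first one has positive real part: the curve `t ↦ f (e^{it} z)` lies
strictly on one side of its tangent at `f z` (`re_sub_mul_conj_pos_sphere`). This holds because
convexity makes the tangent angle increase, by `2π` over one circuit.

The minimum principle in `ζ` carries the bound from the circle to the disc. It needs a holomorphic
expression, hence `d_ζ f(z) ≠ 0`, which comes from the same principle applied to the supporting-line
inequality. The singularities at `ζ = 0, 1` disappear in the form given by `zetaExpr_eq`.

Sharpness comes from `z / (1 - z)`, for which the expression is `1 / (1 - z)` whatever `ζ` is. -/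

/-- A strictly increasing angle function making one full turn on `[0, T]` makes a function whose
derivative has the sign of the sine of the angle, and which vanishes at both ends, positive in
between. -/
lemma pos_of_deriv_eq_mul_sin {D ψ c : ℝ → ℝ} {T : ℝ} (hT : 0 < T) (hψ : StrictMono ψ)
    (hψc : Continuous ψ) (hψ0 : ψ 0 = 0) (hψT : ψ T = 2 * Real.pi) (hc : ∀ t, 0 < c t)
    (hD : ∀ t, HasDerivAt D (c t * Real.sin (ψ t)) t) (hD0 : D 0 = 0) (hDT : D T = 0)
    {t : ℝ} (ht : t ∈ Ioo 0 T) : 0 < D t := by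
  -- `D` increases until the angle reaches `π` and decreases afterwards.
  obtain ⟨s, hs, hsπ⟩ : Real.pi ∈ ψ '' Icc 0 T :=
    intermediate_value_Icc hT.le hψc.continuousOn
      ⟨by rw [hψ0]; positivity, by rw [hψT]; linarith [Real.pi_pos]⟩
  have hDc : Continuous D := continuous_iff_continuousAt.2 fun t => (hD t).continuousAt
  have h1 : StrictMonoOn D (Icc 0 s) := by
    refine strictMonoOn_of_deriv_pos (convex_Icc _ _) hDc.continuousOn fun x hx => ?_
    rw [interior_Icc] at hx
    rw [(hD x).deriv]
    refine mul_pos (hc x) (Real.sin_pos_of_pos_of_lt_pi ?_ ?_)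
    · rw [← hψ0]; exact hψ hx.1
    · rw [← hsπ]; exact hψ hx.2
  have h2 : StrictAntiOn D (Icc s T) := by
    refine strictAntiOn_of_deriv_neg (convex_Icc _ _) hDc.continuousOn fun x hx => ?_
    rw [interior_Icc] at hx
    rw [(hD x).deriv]
    refine mul_neg_of_pos_of_neg (hc x) ?_
    have := hψ hx.1
    have := hψ hx.2
    rw [← Real.sin_sub_two_pi]
    exact Real.sin_neg_of_neg_of_neg_pi_lt (by linarith) (by linarith)
  rcases le_total t s with h | h
  · rw [← hD0]
    exact h1 ⟨le_rfl, hs.1⟩ ⟨ht.1.le, h⟩ ht.1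
  · rw [← hDT]
    exact h2 ⟨h, ht.2.le⟩ ⟨hs.2, le_rfl⟩ ht.2

/-- Minimum principle for the real part of a holomorphic function on the unit disc. -/
lemma re_pos_of_re_nonneg_sphere {g : ℂ → ℂ} (hg : DiffContOnCl ℂ g (ball 0 1))
    (h0 : ∀ ζ ∈ sphere (0 : ℂ) 1, 0 ≤ (g ζ).re) {ξ : ℂ} (hξ : ξ ∈ sphere (0 : ℂ) 1)
    (hpos : 0 < (g ξ).re) {ζ : ℂ} (hζ : ζ ∈ ball (0 : ℂ) 1) : 0 < (g ζ).re := by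
  by_contra! hle
  -- The modulus of `exp (-g)` is `exp (-Re g)`, at most `1` on the circle. An interior point with
  -- `Re g ≤ 0` would make it constant, against its value at `ξ`.
  have hE : DiffContOnCl ℂ (fun ζ => exp (-g ζ)) (ball 0 1) :=
    (differentiable_exp (𝕜 := ℂ)).comp_diffContOnCl hg.neg
  have hbd : ∀ x ∈ closure (ball (0 : ℂ) 1), ‖exp (-g x)‖ ≤ 1 := fun x hx =>
    norm_le_of_forall_mem_frontier_norm_le isBounded_ball hE (fun y hy => by
      rw [frontier_ball _ one_ne_zero] at hy
      rw [norm_exp]; simpa using h0 y hy) hx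
  have hge : 1 ≤ ‖exp (-g ζ)‖ := by rw [norm_exp]; simpa using hle
  have hmax : IsMaxOn (norm ∘ fun ζ => exp (-g ζ)) (ball 0 1) ζ := fun x hx =>
    (hbd x (subset_closure hx)).trans hge
  have := norm_eqOn_closure_of_isPreconnected_of_isMaxOn (convex_ball _ _).isPreconnected
    isOpen_ball hE hζ hmax (x := ξ) (by
      rw [closure_ball _ one_ne_zero]; exact sphere_subset_closedBall hξ)
  simp only [Function.comp, Function.const] at this
  rw [← this, norm_exp, Real.one_le_exp_iff] at hge
  simp at hge
  linarith

/-- A nonvanishing holomorphic function on a disc is an exponential. -/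
lemma exists_eq_mul_exp {k : ℂ → ℂ} {c : ℂ} {r : ℝ} (hk : DifferentiableOn ℂ k (ball c r))
    (hk0 : ∀ z ∈ ball c r, k z ≠ 0) :
    ∃ (F : ℂ → ℂ) (a : ℂ), (∀ z ∈ ball c r, HasDerivAt F (deriv k z / k z) z) ∧
      ∀ z ∈ ball c r, k z = a * exp (F z) := by
  obtain ⟨F, hF⟩ := ((hk.deriv isOpen_ball).div hk hk0).isExactOn_ball
  have hd : ∀ z ∈ ball c r, HasDerivAt (fun z => k z * exp (-F z)) 0 z := fun z hz => by
    refine ((hk.differentiableAt (isOpen_ball.mem_nhds hz)).hasDerivAt.mul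
      (hF z hz).fun_neg.cexp).congr_deriv ?_
    have := hk0 z hz
    simp only [Pi.div_apply]
    field_simp
    ring
  obtain ⟨a, ha⟩ := isOpen_ball.exists_is_const_of_deriv_eq_zero
    (convex_ball c r).isPreconnected
    (fun z hz => (hd z hz).differentiableAt.differentiableWithinAt) (fun z hz => (hd z hz).deriv)
  refine ⟨F, a, hF, fun z hz => ?_⟩
  rw [← ha z hz, mul_assoc, ← exp_add]
  simp

/-! ### Supporting lines of the level curves -/

namespace IsConvexUnivalent

variable {f : ℂ → ℂ}

/-- Write `f' = a exp F`. The tangent angle relative to its value at `t = 0` is `ψ = t + Im F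
(e^{it} z) - Im F z`, and `ψ' = Re (1 + w f''(w) / f'(w)) > 0` at `w = e^{it} z`. The quantity here
has derivative a positive multiple of `sin ψ`. -/
lemma re_sub_mul_conj_pos_exp (hf : IsConvexUnivalent f) {z : ℂ} (hz : z ∈ ball (0 : ℂ) 1)
    (hz0 : z ≠ 0) {t : ℝ} (ht : t ∈ Ioo 0 (2 * Real.pi)) :
    0 < ((f z - f (exp (t * I) * z)) * conj (z * deriv f z)).re := by
  obtain ⟨F, a, hF, hFa⟩ :=
    exists_eq_mul_exp (hf.differentiableOn.deriv isOpen_ball) hf.deriv_ne_zero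
  have ha : a ≠ 0 := by
    rintro rfl
    exact hf.deriv_ne_zero z hz (by simp [hFa z hz])
  have hmem : ∀ t : ℝ, exp (t * I) * z ∈ ball (0 : ℂ) 1 := fun t => by
    simpa [norm_exp_ofReal_mul_I] using hz
  have hw : ∀ t : ℝ, HasDerivAt (fun t : ℝ => exp (t * I) * z) (I * (exp (t * I) * z)) t :=
    fun t => by
      refine (((hasDerivAt_id (t : ℂ)).mul_const I).cexp.mul_const z).comp_ofReal.congr_deriv ?_
      simp only [id]; ring
  have hFw : ∀ t : ℝ, HasDerivAt (fun t : ℝ => F (exp (t * I) * z))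
      (I * (exp (t * I) * z * deriv (deriv f) (exp (t * I) * z) / deriv f (exp (t * I) * z))) t :=
    fun t => by
      refine ((hF _ (hmem t)).comp t (hw t)).congr_deriv ?_
      ring
  have hψ' : ∀ t : ℝ, HasDerivAt (fun t : ℝ => t + (F (exp (t * I) * z)).im - (F z).im)
      (1 + exp (t * I) * z * deriv (deriv f) (exp (t * I) * z) / deriv f (exp (t * I) * z)).re t :=
    fun t => by
      refine (((hasDerivAt_id t).add
        (imCLM.hasFDerivAt.comp_hasDerivAt t (hFw t))).sub_const (F z).im).congr_deriv ?_
      simp only [imCLM_apply, I_mul_im, add_re, one_re]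
  have hfw : ∀ t : ℝ, HasDerivAt (fun t : ℝ => f (exp (t * I) * z))
      (deriv f (exp (t * I) * z) * (I * (exp (t * I) * z))) t := fun t =>
    (hf.differentiableOn.differentiableAt (isOpen_ball.mem_nhds (hmem t))).hasDerivAt.comp t (hw t)
  refine pos_of_deriv_eq_mul_sin (T := 2 * Real.pi)
    (D := fun t => ((f z - f (exp (t * I) * z)) * conj (z * deriv f z)).re)
    (ψ := fun t => t + (F (exp (t * I) * z)).im - (F z).im)
    (c := fun t => ‖a * z‖ ^ 2 * Real.exp ((F (exp (t * I) * z)).re + (F z).re))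
    Real.two_pi_pos
    (strictMono_of_deriv_pos fun t => by rw [(hψ' t).deriv]; exact hf.re_pos _ (hmem t))
    (continuous_iff_continuousAt.2 fun t => (hψ' t).continuousAt)
    (by simp) (by simp) (fun t => mul_pos (pow_pos (norm_pos_iff.2 (mul_ne_zero ha hz0)) 2) (Real.exp_pos _))
    (fun t => ?_) (by simp) (by simp) ht
  have := reCLM.hasFDerivAt.comp_hasDerivAt t
    (((hfw t).const_sub (f z)).mul_const (conj (z * deriv f z)))
  refine this.congr_deriv ?_
  have key : -(deriv f (exp (t * I) * z) * (I * (exp (t * I) * z))) * conj (z * deriv f z) =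
      -I * ((‖a * z‖ ^ 2 : ℝ) *
        exp ((t + (F (exp (t * I) * z)).im - (F z).im : ℝ) * I +
          ((F (exp (t * I) * z)).re + (F z).re : ℝ))) := by
    rw [hFa _ (hmem t), hFa z hz]
    have e1 : ((‖a * z‖ ^ 2 : ℝ) : ℂ) = a * z * (conj a * conj z) := by
      rw [← map_mul, mul_conj, normSq_eq_norm_sq]
    have e2 : (t + (F (exp (t * I) * z)).im - (F z).im : ℝ) * I +
          ((F (exp (t * I) * z)).re + (F z).re : ℝ) =
        t * I + F (exp (t * I) * z) + conj (F z) := by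
      apply Complex.ext <;> simp
      ring
    rw [e1, e2, exp_add, exp_add]
    simp only [map_mul, ← exp_conj]
    ring
  simp only [reCLM_apply]
  rw [key]
  generalize t + (F (exp (t * I) * z)).im - (F z).im = u
  generalize (F (exp (t * I) * z)).re + (F z).re = v
  rw [neg_mul, neg_re, I_mul_re, neg_neg, im_ofReal_mul, exp_im]
  simp [mul_assoc]

/-- The tangent to a level curve of a convex function is a strict supporting line. -/
lemma re_sub_mul_conj_pos_sphere (hf : IsConvexUnivalent f) {z : ℂ} (hz : z ∈ ball (0 : ℂ) 1)
    (hz0 : z ≠ 0) {ζ : ℂ} (hζ : ζ ∈ sphere (0 : ℂ) 1) (hζ1 : ζ ≠ 1) :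
    0 < ((f z - f (ζ * z)) * conj (z * deriv f z)).re := by
  have hn : ‖ζ‖ = 1 := by simpa using hζ
  have harg : exp (arg ζ * I) = ζ := by simpa [hn] using norm_mul_exp_arg_mul_I ζ
  have harg0 : arg ζ ≠ 0 := fun h => hζ1 (by simpa [h] using harg.symm)
  rcases harg0.lt_or_gt with h | h
  -- A negative argument is moved into `(0, 2π)`.
  · have h2 := hf.re_sub_mul_conj_pos_exp hz hz0 (t := arg ζ + 2 * Real.pi)
      ⟨by linarith [neg_pi_lt_arg ζ, Real.pi_pos], by linarith⟩
    have : exp ((arg ζ + 2 * Real.pi : ℝ) * I) = ζ := by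
      push_cast
      rw [add_mul, exp_add, exp_two_pi_mul_I, mul_one, harg]
    rwa [this] at h2
  · have h2 := hf.re_sub_mul_conj_pos_exp hz hz0 (t := arg ζ)
      ⟨h, by linarith [arg_le_pi ζ, Real.pi_pos]⟩
    rwa [harg] at h2

end IsConvexUnivalent

/-! ### Closed form of the Hadamard product -/

lemma taylorCoeffZero_eq_of_hasSum {g : ℂ → ℂ} {c : ℕ → ℂ}
    (h : ∀ z ∈ ball (0 : ℂ) 1, HasSum (fun n => c n * z ^ n) (g z)) (n : ℕ) :
    taylorCoeffZero g n = c n := by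
  have h1 : HasFPowerSeriesAt g (FormalMultilinearSeries.ofScalars ℂ c) 0 := by
    rw [hasFPowerSeriesAt_iff]
    filter_upwards [ball_mem_nhds (0 : ℂ) one_pos] with z hz
    simpa [mul_comm] using h z hz
  have h2 := h1.analyticAt.hasFPowerSeriesAt
  have := congr_arg (FormalMultilinearSeries.coeff · n) (h2.eq_formalMultilinearSeries h1)
  simpa [taylorCoeffZero] using this

lemma hasSum_taylorCoeffZero {f : ℂ → ℂ} (hf : DifferentiableOn ℂ f (ball 0 1)) {z : ℂ}
    (hz : z ∈ ball (0 : ℂ) 1) : HasSum (fun n => taylorCoeffZero f n * z ^ n) (f z) := by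
  convert! hasSum_taylorSeries_on_ball hf hz using 2 with n
  simp only [taylorCoeffZero, sub_zero, smul_eq_mul]
  ring

lemma one_sub_ne_zero {z : ℂ} (hz : ‖z‖ < 1) : 1 - z ≠ 0 := by
  rw [sub_ne_zero]
  rintro rfl
  simp at hz

lemma norm_mul_lt_one {ζ z : ℂ} (hζ : ζ ∈ closedBall (0 : ℂ) 1) (hz : z ∈ ball (0 : ℂ) 1) :
    ‖ζ * z‖ < 1 := by
  rw [norm_mul]
  rw [mem_closedBall_zero_iff] at hζ
  rw [mem_ball_zero_iff] at hz
  nlinarith [norm_nonneg z]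

lemma taylorCoeffZero_hZeta {ζ : ℂ} (hζ : ζ ∈ closedBall (0 : ℂ) 1) (hζ1 : ζ ≠ 1) (n : ℕ) :
    taylorCoeffZero (hZeta ζ) n = (1 - ζ ^ n) / (1 - ζ) := by
  refine taylorCoeffZero_eq_of_hasSum (c := fun n => (1 - ζ ^ n) / (1 - ζ)) (fun z hz => ?_) n
  have hζ1' : 1 - ζ ≠ 0 := sub_ne_zero.2 hζ1.symm
  have hz1 : 1 - z ≠ 0 := one_sub_ne_zero (by simpa using hz)
  have hz2 : 1 - ζ * z ≠ 0 := one_sub_ne_zero (norm_mul_lt_one hζ hz)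
  convert! ((hasSum_geometric_of_norm_lt_one (ξ := z) (by simpa using hz)).sub
    (hasSum_geometric_of_norm_lt_one (norm_mul_lt_one hζ hz))).div_const (1 - ζ) using 1
  · ext n
    rw [mul_pow]; ring
  · have e : 1 - ζ * z - (1 - z) = z * (1 - ζ) := by ring
    rw [hZeta, inv_sub_inv hz1 hz2, e, div_right_comm, mul_div_cancel_right₀ _ hζ1',
      mul_comm (1 - z)]

lemma taylorCoeffZero_hZeta_one (n : ℕ) : taylorCoeffZero (hZeta 1) n = n := by
  refine taylorCoeffZero_eq_of_hasSum (c := fun n => (n : ℂ)) (fun z hz => ?_) n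
  convert! hasSum_coe_mul_geometric_of_norm_lt_one (𝕜 := ℂ) (r := z) (by simpa using hz) using 1
  rw [hZeta, one_mul, sq]

lemma hadamardProduct_hZeta {f : ℂ → ℂ} (hf : DifferentiableOn ℂ f (ball 0 1)) {ζ : ℂ}
    (hζ : ζ ∈ closedBall (0 : ℂ) 1) (hζ1 : ζ ≠ 1) {z : ℂ} (hz : z ∈ ball (0 : ℂ) 1) :
    hadamardProduct f (hZeta ζ) z = (f z - f (ζ * z)) / (1 - ζ) := by
  refine HasSum.tsum_eq ?_
  convert! ((hasSum_taylorCoeffZero hf hz).sub (hasSum_taylorCoeffZero hf (z := ζ * z)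
    (by simpa using norm_mul_lt_one hζ hz))).div_const (1 - ζ) using 1
  ext n
  rw [taylorCoeffZero_hZeta hζ hζ1, mul_pow]
  ring

lemma hadamardProduct_hZeta_one {f : ℂ → ℂ} (hf : DifferentiableOn ℂ f (ball 0 1)) {z : ℂ}
    (hz : z ∈ ball (0 : ℂ) 1) : hadamardProduct f (hZeta 1) z = z * deriv f z := by
  refine HasSum.tsum_eq ?_
  rw [← hasSum_nat_add_iff' 1]
  convert! (hasSum_taylorCoeffZero (hf.deriv isOpen_ball) hz).mul_left z using 1
  · ext n
    have : (n : ℂ) + 1 ≠ 0 := by exact_mod_cast n.succ_ne_zero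
    have : (n.factorial : ℂ) ≠ 0 := by exact_mod_cast n.factorial_ne_zero
    rw [taylorCoeffZero_hZeta_one, taylorCoeffZero, taylorCoeffZero, iteratedDeriv_succ',
      Nat.factorial_succ]
    push_cast
    field_simp
    ring
  · simp [taylorCoeffZero_hZeta_one]

lemma IsNormalizedAnalytic.zetaDeriv_zero {f : ℂ → ℂ} (hf : IsNormalizedAnalytic f) {ζ : ℂ}
    (hζ : ζ ∈ closedBall (0 : ℂ) 1) : zetaDeriv ζ f 0 = 1 := by
  have hnhds : ball (0 : ℂ) 1 ∈ 𝓝 0 := ball_mem_nhds _ one_pos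
  have hd : HasDerivAt f 1 0 := by
    rw [← hf.deriv_zero]
    exact (hf.differentiableOn.differentiableAt hnhds).hasDerivAt
  rw [zetaDeriv, if_pos rfl]
  rcases eq_or_ne ζ 1 with rfl | hζ1
  · have : hadamardProduct f (hZeta 1) =ᶠ[𝓝 0] fun z => z * deriv f z := by
      filter_upwards [hnhds] with z hz using hadamardProduct_hZeta_one hf.differentiableOn hz
    rw [this.deriv_eq]
    have h2 := ((hf.differentiableOn.deriv isOpen_ball).differentiableAt hnhds).hasDerivAt
    simpa [hf.deriv_zero] using ((hasDerivAt_id (0 : ℂ)).fun_mul h2).deriv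
  · have : hadamardProduct f (hZeta ζ) =ᶠ[𝓝 0] fun z => (f z - f (ζ * z)) / (1 - ζ) := by
      filter_upwards [hnhds] with z hz using hadamardProduct_hZeta hf.differentiableOn hζ hζ1 hz
    rw [this.deriv_eq]
    have h2 : HasDerivAt (fun z => f (ζ * z)) (1 * ζ) 0 :=
      HasDerivAt.comp (h₂ := f) (h := fun z => ζ * z) 0 (by simpa using hd)
        (by simpa using (hasDerivAt_id (0 : ℂ)).const_mul ζ)
    rw [((hd.fun_sub h2).div_const (1 - ζ)).deriv, one_mul, div_self (sub_ne_zero.2 hζ1.symm)]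

/-! ### Removing the singularities in `ζ` -/

/-- The difference quotient at `1` of `ζ ↦ f (ζ z)`. -/
def zetaSlope (f : ℂ → ℂ) (z : ℂ) : ℂ → ℂ := dslope (fun ζ => f (ζ * z)) 1

section Slope

variable {f : ℂ → ℂ} {z : ℂ}

lemma hasDerivAt_comp_mul_right {ζ : ℂ} (hf : DifferentiableOn ℂ f (ball 0 1))
    (h : ζ * z ∈ ball (0 : ℂ) 1) : HasDerivAt (fun ζ => f (ζ * z)) (z * deriv f (ζ * z)) ζ := by
  refine (HasDerivAt.comp (h₂ := f) (h := fun ζ => ζ * z) ζ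
    (hf.differentiableAt (isOpen_ball.mem_nhds h)).hasDerivAt
    ((hasDerivAt_id ζ).mul_const z)).congr_deriv ?_
  rw [one_mul, mul_comm]

lemma zetaSlope_of_ne {ζ : ℂ} (hζ1 : ζ ≠ 1) :
    zetaSlope f z ζ = (f z - f (ζ * z)) / (1 - ζ) := by
  rw [zetaSlope, dslope_of_ne _ hζ1, slope_def_field, one_mul, ← neg_sub, ← neg_sub 1 ζ,
    neg_div_neg_eq]

lemma zetaSlope_one (hf : DifferentiableOn ℂ f (ball 0 1)) (hz : z ∈ ball (0 : ℂ) 1) :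
    zetaSlope f z 1 = z * deriv f z := by
  rw [zetaSlope, dslope_same, (hasDerivAt_comp_mul_right hf (by simpa using hz)).deriv, one_mul]

/-- The open set of `ζ` with `ζ z` in the unit disc. -/
def zetaDomain (z : ℂ) : Set ℂ := (fun ζ => ζ * z) ⁻¹' ball 0 1

lemma isOpen_zetaDomain (z : ℂ) : IsOpen (zetaDomain z) :=
  isOpen_ball.preimage (continuous_mul_const z)

lemma closedBall_subset_zetaDomain (hz : z ∈ ball (0 : ℂ) 1) :
    closedBall (0 : ℂ) 1 ⊆ zetaDomain z := fun ζ hζ => by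
  simpa [zetaDomain] using norm_mul_lt_one hζ hz

lemma zetaDomain_mem_nhds_one (hz : z ∈ ball (0 : ℂ) 1) : zetaDomain z ∈ 𝓝 1 :=
  (isOpen_zetaDomain z).mem_nhds (closedBall_subset_zetaDomain hz (by simp))

lemma differentiableOn_zetaSlope (hf : DifferentiableOn ℂ f (ball 0 1))
    (hz : z ∈ ball (0 : ℂ) 1) : DifferentiableOn ℂ (zetaSlope f z) (zetaDomain z) :=
  (differentiableOn_dslope (zetaDomain_mem_nhds_one hz)).2 fun _ hζ =>
    (hasDerivAt_comp_mul_right hf hζ).differentiableAt.differentiableWithinAt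

/-- Differentiating `f (ζ z) = f z + (ζ - 1) Q(ζ)` twice at `ζ = 1` gives `z² f''(z) = 2 Q'(1)`. -/
lemma deriv_zetaSlope_one (hf : DifferentiableOn ℂ f (ball 0 1)) (hz : z ∈ ball (0 : ℂ) 1) :
    deriv (zetaSlope f z) 1 = z ^ 2 * deriv (deriv f) z / 2 := by
  have hN := zetaDomain_mem_nhds_one hz
  have hQ := differentiableOn_zetaSlope hf hz
  have hQ' := hQ.deriv (isOpen_zetaDomain z)
  have h1 : (fun ζ => z * deriv f (ζ * z)) =ᶠ[𝓝 1]
      fun ζ => zetaSlope f z ζ + (ζ - 1) * deriv (zetaSlope f z) ζ := by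
    filter_upwards [hN] with ζ hζ
    refine (hasDerivAt_comp_mul_right hf hζ).unique ?_
    have := (((hasDerivAt_id ζ).sub_const 1).fun_mul
      (hQ.differentiableAt ((isOpen_zetaDomain z).mem_nhds hζ)).hasDerivAt).add_const (f z)
    refine (this.congr_deriv (by simp)).congr_of_eventuallyEq (.of_forall fun x => ?_)
    have := sub_smul_dslope (fun ζ => f (ζ * z)) 1 x
    simp only [smul_eq_mul, one_mul] at this
    simp [zetaSlope, this]
  have h2 : HasDerivAt (fun ζ => z * deriv f (ζ * z)) (z * (z * deriv (deriv f) (1 * z))) 1 :=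
    (hasDerivAt_comp_mul_right (hf.deriv isOpen_ball) (by simpa using hz)).const_mul z
  have h3 := (hQ.differentiableAt hN).hasDerivAt.fun_add
    (((hasDerivAt_id (1 : ℂ)).sub_const 1).fun_mul (hQ'.differentiableAt hN).hasDerivAt)
  have := h2.unique (h3.congr_of_eventuallyEq h1)
  simp only [one_mul, id, sub_self, zero_mul, add_zero] at this
  linear_combination -this / 2

lemma zetaDeriv_eq (hf : DifferentiableOn ℂ f (ball 0 1)) (hz : z ∈ ball (0 : ℂ) 1)
    (hz0 : z ≠ 0) {ζ : ℂ} (hζ : ζ ∈ closedBall (0 : ℂ) 1) :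
    zetaDeriv ζ f z = zetaSlope f z ζ / z := by
  rw [zetaDeriv, if_neg hz0, one_div_mul_eq_div]
  rcases eq_or_ne ζ 1 with rfl | hζ1
  · rw [hadamardProduct_hZeta_one hf hz, zetaSlope_one hf hz]
  · rw [hadamardProduct_hZeta hf hζ hζ1 hz, zetaSlope_of_ne hζ1]

/-- With `Q = z d_ζ f(z)` and `Q(1) = z f'(z)`, the expression is `(Q(1) - ζ Q(ζ)) / ((1 - ζ)
Q(ζ))`. This form is holomorphic wherever `Q ≠ 0` and includes both exceptional values of `ζ`. -/
lemma zetaExpr_eq (hf : DifferentiableOn ℂ f (ball 0 1)) (hz : z ∈ ball (0 : ℂ) 1)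
    (hz0 : z ≠ 0) {ζ : ℂ} (hζ : ζ ∈ closedBall (0 : ℂ) 1) (hQ : zetaSlope f z ζ ≠ 0) :
    zetaExpr f ζ z = 1 + dslope (zetaSlope f z) 1 ζ / zetaSlope f z ζ := by
  rw [zetaExpr]
  have h0 : (0 : ℂ) ∈ closedBall (0 : ℂ) 1 := by simp
  split_ifs with hζ0 hζ1
  · subst hζ0
    rw [zetaDeriv_eq hf hz hz0 h0, dslope_of_ne _ zero_ne_one, slope_def_field,
      zetaSlope_one hf hz]
    field_simp
    ring
  · subst hζ1
    rw [zetaSlope_one hf hz] at hQ ⊢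
    rw [dslope_same, deriv_zetaSlope_one hf hz]
    have : deriv f z ≠ 0 := right_ne_zero_of_mul hQ
    field_simp
  · have : 1 - ζ ≠ 0 := sub_ne_zero.2 (Ne.symm hζ1)
    have : ζ - 1 ≠ 0 := sub_ne_zero.2 hζ1
    rw [zetaDeriv_eq hf hz hz0 hζ, dslope_of_ne _ hζ1, slope_def_field, zetaSlope_one hf hz]
    field_simp
    ring

end Slope

lemma IsNormalizedAnalytic.zetaExpr_zero {f : ℂ → ℂ} (hf : IsNormalizedAnalytic f) {ζ : ℂ}
    (hζ : ζ ∈ closedBall (0 : ℂ) 1) : zetaExpr f ζ 0 = 1 := by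
  rw [zetaExpr, hf.zetaDeriv_zero hζ, hf.zetaDeriv_zero (by simp), hf.deriv_zero]
  split_ifs with hζ0 hζ1
  · simp
  · simp
  · have : 1 - ζ ≠ 0 := sub_ne_zero.2 (Ne.symm hζ1)
    field_simp

/-! ### Nonvanishing and the bound, from the circle to the disc -/

namespace IsConvexUnivalent

variable {f : ℂ → ℂ} {z : ℂ}

lemma zetaSlope_ne_zero (hf : IsConvexUnivalent f) (hz : z ∈ ball (0 : ℂ) 1) (hz0 : z ≠ 0)
    {ζ : ℂ} (hζ : ζ ∈ closedBall (0 : ℂ) 1) : zetaSlope f z ζ ≠ 0 := by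
  rcases eq_or_ne ζ 1 with rfl | hζ1
  · rw [zetaSlope_one hf.differentiableOn hz]
    exact mul_ne_zero hz0 (hf.deriv_ne_zero z hz)
  suffices h : 0 < ((f z - f (ζ * z)) * conj (z * deriv f z)).re by
    rw [zetaSlope_of_ne hζ1]
    refine div_ne_zero (fun h0 => ?_) (sub_ne_zero.2 hζ1.symm)
    simp [h0] at h
  have hsph : ∀ ξ ∈ sphere (0 : ℂ) 1, ξ ≠ 1 →
      0 < ((f z - f (ξ * z)) * conj (z * deriv f z)).re := fun ξ hξ hξ1 =>
    hf.re_sub_mul_conj_pos_sphere hz hz0 hξ hξ1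
  rw [← ball_union_sphere] at hζ
  rcases hζ with hζ | hζ
  -- The function vanishes at `ξ = 1`, so strictness is taken from `ξ = -1`.
  · refine re_pos_of_re_nonneg_sphere (g := fun ζ => (f z - f (ζ * z)) * conj (z * deriv f z))
      (ξ := -1) (DifferentiableOn.diffContOnCl ?_) (fun ξ hξ => ?_) (by simp)
      (hsph _ (by simp) (by norm_num)) hζ
    · rw [closure_ball _ one_ne_zero]
      intro ξ hξ
      exact (((hasDerivAt_comp_mul_right hf.differentiableOn
        (closedBall_subset_zetaDomain hz hξ)).const_sub (f z)).mul_const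
        _).differentiableAt.differentiableWithinAt
    · rcases eq_or_ne ξ 1 with rfl | hξ1
      · simp
      · exact (hsph ξ hξ hξ1).le
  · exact hsph ζ hζ hζ1

lemma differentiableOn_dslope_div (hf : IsConvexUnivalent f) (hz : z ∈ ball (0 : ℂ) 1)
    (hz0 : z ≠ 0) : DifferentiableOn ℂ
      (fun ζ => 1 + dslope (zetaSlope f z) 1 ζ / zetaSlope f z ζ) (closedBall 0 1) := by
  have hQ := differentiableOn_zetaSlope hf.differentiableOn hz
  have hsub := closedBall_subset_zetaDomain hz
  exact ((((differentiableOn_dslope (zetaDomain_mem_nhds_one hz)).2 hQ).mono hsub).fun_div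
    (hQ.mono hsub) fun ζ hζ => hf.zetaSlope_ne_zero hz hz0 hζ).const_add 1

lemma half_lt_re_zetaExpr_sphere (hf : IsConvexUnivalent f) (hz : z ∈ ball (0 : ℂ) 1)
    (hz0 : z ≠ 0) {ζ : ℂ} (hζ : ζ ∈ sphere (0 : ℂ) 1) : 1 / 2 < (zetaExpr f ζ z).re := by
  have hζc := sphere_subset_closedBall hζ
  have hζ0 : ζ ≠ 0 := ne_of_mem_sphere hζ one_ne_zero
  rcases eq_or_ne ζ 1 with rfl | hζ1
  · have := hf.re_pos z hz
    rw [zetaExpr, if_neg one_ne_zero, if_pos rfl]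
    rw [add_re, one_re] at this ⊢
    have e : z * deriv (deriv f) z / (2 * deriv f z) =
        (1 / 2 : ℝ) * (z * deriv (deriv f) z / deriv f z) := by
      push_cast
      ring
    rw [e, re_ofReal_mul]
    linarith
  · have hd : 1 - ζ ≠ 0 := sub_ne_zero.2 hζ1.symm
    have hQ := hf.zetaSlope_ne_zero hz hz0 hζc
    have hpos := hf.re_sub_mul_conj_pos_sphere hz hz0 hζ hζ1
    rw [zetaSlope_of_ne hζ1] at hQ
    have hfz : f z - f (ζ * z) ≠ 0 := (div_ne_zero_iff.1 hQ).1
    have e : zetaExpr f ζ z = z * deriv f z / (f z - f (ζ * z)) - ζ / (1 - ζ) := by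
      rw [zetaExpr, if_neg hζ0, if_neg hζ1, zetaDeriv_eq hf.differentiableOn hz hz0 hζc,
        zetaSlope_of_ne hζ1]
      field_simp
    have h1 : 0 < (z * deriv f z / (f z - f (ζ * z))).re := by
      have hn := normSq_pos.2 hfz
      rw [div_re, ← add_div]
      refine div_pos ?_ hn
      simp only [mul_re (f z - f (ζ * z)), conj_re, conj_im] at hpos
      linarith
    have h2 : (ζ / (1 - ζ)).re = -(1 / 2) := by
      have hn := normSq_pos.2 hd
      have h3 : normSq ζ = 1 := by
        rw [normSq_eq_norm_sq, mem_sphere_zero_iff_norm.1 hζ, one_pow]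
      rw [div_re, ← add_div, div_eq_iff hn.ne']
      simp only [normSq_apply, sub_re, one_re, sub_im, one_im] at *
      linarith
    rw [e, sub_re, h2]
    linarith

lemma half_lt_re_zetaExpr (hf : IsConvexUnivalent f) (hz : z ∈ ball (0 : ℂ) 1)
    (hz0 : z ≠ 0) {ζ : ℂ} (hζ : ζ ∈ closedBall (0 : ℂ) 1) : 1 / 2 < (zetaExpr f ζ z).re := by
  rw [← ball_union_sphere] at hζ
  rcases hζ with hζ | hζ
  · have hE : ∀ ξ ∈ closedBall (0 : ℂ) 1, (zetaExpr f ξ z).re - 1 / 2 =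
        (1 + dslope (zetaSlope f z) 1 ξ / zetaSlope f z ξ - (1 / 2 : ℝ)).re := fun ξ hξ => by
      rw [sub_re, ofReal_re, zetaExpr_eq hf.differentiableOn hz hz0 hξ
        (hf.zetaSlope_ne_zero hz hz0 hξ)]
    have hs : ∀ ξ ∈ sphere (0 : ℂ) 1,
        0 < (1 + dslope (zetaSlope f z) 1 ξ / zetaSlope f z ξ - (1 / 2 : ℝ)).re := fun ξ hξ => by
      rw [← hE ξ (sphere_subset_closedBall hξ), sub_pos]
      exact hf.half_lt_re_zetaExpr_sphere hz hz0 hξ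
    rw [← sub_pos, hE ζ (ball_subset_closedBall hζ)]
    refine re_pos_of_re_nonneg_sphere
      (g := fun ξ => 1 + dslope (zetaSlope f z) 1 ξ / zetaSlope f z ξ - (1 / 2 : ℝ)) (ξ := 1)
      (DifferentiableOn.diffContOnCl ?_) (fun ξ hξ => (hs ξ hξ).le) (by simp) (hs 1 (by simp)) hζ
    rw [closure_ball _ one_ne_zero]
    exact (hf.differentiableOn_dslope_div hz hz0).sub_const _
  · exact hf.half_lt_re_zetaExpr_sphere hz hz0 hζ

end IsConvexUnivalent

/-! ### The extremal function -/

section HalfPlaneMap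

lemma hasDerivAt_div_one_sub {z : ℂ} (hz : z ≠ 1) :
    HasDerivAt (fun z : ℂ => z / (1 - z)) (1 / (1 - z) ^ 2) z := by
  have : 1 - z ≠ 0 := sub_ne_zero.2 hz.symm
  refine ((hasDerivAt_id z).fun_div ((hasDerivAt_id z).const_sub 1) this).congr_deriv ?_
  simp

lemma deriv_deriv_div_one_sub {z : ℂ} (hz : z ≠ 1) :
    deriv (deriv fun z : ℂ => z / (1 - z)) z = 2 / (1 - z) ^ 3 := by
  have h1 : 1 - z ≠ 0 := sub_ne_zero.2 hz.symm
  have : deriv (fun z : ℂ => z / (1 - z)) =ᶠ[𝓝 z] fun z => 1 / (1 - z) ^ 2 := by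
    filter_upwards [isOpen_ne.mem_nhds hz] with w hw using (hasDerivAt_div_one_sub hw).deriv
  rw [this.deriv_eq]
  refine HasDerivAt.deriv ((((hasDerivAt_const z (1 : ℂ)).fun_div
    (((hasDerivAt_id z).const_sub 1).fun_pow 2) (pow_ne_zero 2 h1))).congr_deriv ?_)
  simp only [id]
  field_simp
  ring

lemma ne_one_of_mem_ball {z : ℂ} (hz : z ∈ ball (0 : ℂ) 1) : z ≠ 1 := by
  rintro rfl
  simp at hz

lemma half_lt_re_one_div_one_sub {z : ℂ} (hz : z ∈ ball (0 : ℂ) 1) :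
    1 / 2 < (1 / (1 - z)).re := by
  have h1 : 1 - z ≠ 0 := one_sub_ne_zero (by simpa using hz)
  have h2 : normSq z < 1 := by
    rw [normSq_eq_norm_sq]
    have : ‖z‖ < 1 := by simpa using hz
    nlinarith [norm_nonneg z]
  have h3 := normSq_pos.2 h1
  rw [one_div (1 - z), inv_re, lt_div_iff₀ h3]
  simp only [normSq_apply, sub_re, one_re, sub_im, one_im] at *
  nlinarith

lemma isConvexUnivalent_div_one_sub : IsConvexUnivalent fun z => z / (1 - z) where
  differentiableOn z hz :=
    (hasDerivAt_div_one_sub (ne_one_of_mem_ball hz)).differentiableAt.differentiableWithinAt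
  map_zero := by simp
  deriv_zero := by simp [(hasDerivAt_div_one_sub zero_ne_one).deriv]
  deriv_ne_zero z hz := by
    rw [(hasDerivAt_div_one_sub (ne_one_of_mem_ball hz)).deriv]
    exact one_div_ne_zero (pow_ne_zero 2 (one_sub_ne_zero (by simpa using hz)))
  re_pos z hz := by
    have h1 : 1 - z ≠ 0 := one_sub_ne_zero (by simpa using hz)
    have h2 := half_lt_re_one_div_one_sub hz
    have : 1 + z * (2 / (1 - z) ^ 3) / (1 / (1 - z) ^ 2) = (2 : ℝ) * (1 / (1 - z)) - 1 := by
      push_cast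
      field_simp
      ring
    rw [deriv_deriv_div_one_sub (ne_one_of_mem_ball hz),
      (hasDerivAt_div_one_sub (ne_one_of_mem_ball hz)).deriv, this, sub_re, re_ofReal_mul, one_re]
    linarith

lemma zetaDeriv_div_one_sub {ζ : ℂ} (hζ : ζ ∈ closedBall (0 : ℂ) 1) {z : ℂ}
    (hz : z ∈ ball (0 : ℂ) 1) :
    zetaDeriv ζ (fun z => z / (1 - z)) z = 1 / ((1 - z) * (1 - ζ * z)) := by
  have hf := isConvexUnivalent_div_one_sub
  have h1 : 1 - z ≠ 0 := one_sub_ne_zero (by simpa using hz)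
  have h2 : 1 - ζ * z ≠ 0 := one_sub_ne_zero (norm_mul_lt_one hζ hz)
  rcases eq_or_ne z 0 with rfl | hz0
  · rw [hf.zetaDeriv_zero hζ]; simp
  rw [zetaDeriv_eq hf.differentiableOn hz hz0 hζ]
  rcases eq_or_ne ζ 1 with rfl | hζ1
  · rw [zetaSlope_one hf.differentiableOn hz,
      (hasDerivAt_div_one_sub (ne_one_of_mem_ball hz)).deriv]
    field_simp
  · have : 1 - ζ ≠ 0 := sub_ne_zero.2 hζ1.symm
    have e : z / (1 - z) - ζ * z / (1 - ζ * z) =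
        (1 - ζ) * z / ((1 - z) * (1 - ζ * z)) := by
      rw [div_sub_div _ _ h1 h2]
      ring
    rw [zetaSlope_of_ne hζ1, e]
    generalize 1 - ζ * z = u at *
    field_simp

lemma zetaExpr_div_one_sub {ζ : ℂ} (hζ : ζ ∈ closedBall (0 : ℂ) 1) {z : ℂ}
    (hz : z ∈ ball (0 : ℂ) 1) : zetaExpr (fun z => z / (1 - z)) ζ z = 1 / (1 - z) := by
  have h1 : 1 - z ≠ 0 := one_sub_ne_zero (by simpa using hz)
  have h2 : 1 - ζ * z ≠ 0 := one_sub_ne_zero (norm_mul_lt_one hζ hz)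
  rw [zetaExpr, zetaDeriv_div_one_sub hζ hz, zetaDeriv_div_one_sub (by simp) hz,
    deriv_deriv_div_one_sub (ne_one_of_mem_ball hz),
    (hasDerivAt_div_one_sub (ne_one_of_mem_ball hz)).deriv]
  split_ifs with hζ0 hζ1
  · field_simp
    ring
  · field_simp
    ring
  · have : 1 - ζ ≠ 0 := sub_ne_zero.2 (Ne.symm hζ1)
    field_simp
    ring

lemma image_one_div_one_sub :
    (fun z : ℂ => 1 / (1 - z)) '' ball 0 1 = {w : ℂ | 1 / 2 < w.re} := by
  ext w
  constructor
  · rintro ⟨z, hz, rfl⟩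
    exact half_lt_re_one_div_one_sub hz
  · intro hw
    simp only [mem_ofPred_eq] at hw
    have hw0 : w ≠ 0 := by rintro rfl; norm_num at hw
    refine ⟨1 - 1 / w, ?_, by simp⟩
    have : 1 - 1 / w = (w - 1) / w := by field_simp
    rw [this, mem_ball_zero_iff, norm_div, div_lt_one (norm_pos_iff.2 hw0),
      ← sq_lt_sq₀ (norm_nonneg _) (norm_nonneg _), ← normSq_eq_norm_sq, ← normSq_eq_norm_sq]
    simp only [normSq_apply, sub_re, one_re, sub_im, one_im]
    nlinarith

end HalfPlaneMap

end

theorem theoremt22 :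
    (∀ f : ℂ → ℂ, IsConvexUnivalent f → ∀ z ∈ ball (0 : ℂ) 1,
      (∀ ζ ∈ closedBall (0 : ℂ) 1, zetaDeriv ζ f z ≠ 0) ∧
      ContinuousOn (fun ζ => zetaExpr f ζ z) (closedBall (0 : ℂ) 1) ∧
      ∀ ζ ∈ closedBall (0 : ℂ) 1, 1 / 2 < (zetaExpr f ζ z).re) ∧
    IsConvexUnivalent (fun z => z / (1 - z)) ∧
    ∀ ζ ∈ closedBall (0 : ℂ) 1,
      (∀ z ∈ ball (0 : ℂ) 1, zetaExpr (fun z => z / (1 - z)) ζ z = 1 / (1 - z)) ∧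
      (fun z => zetaExpr (fun z => z / (1 - z)) ζ z) '' ball (0 : ℂ) 1 = {w : ℂ | 1 / 2 < w.re} ∧
      IsGLB {x : ℝ | ∃ f : ℂ → ℂ, IsConvexUnivalent f ∧ ∃ z ∈ ball (0 : ℂ) 1,
        x = (zetaExpr f ζ z).re} (1 / 2) := by
  have main : ∀ f : ℂ → ℂ, IsConvexUnivalent f → ∀ z ∈ ball (0 : ℂ) 1,
      (∀ ζ ∈ closedBall (0 : ℂ) 1, zetaDeriv ζ f z ≠ 0) ∧
      ContinuousOn (fun ζ => zetaExpr f ζ z) (closedBall (0 : ℂ) 1) ∧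
      ∀ ζ ∈ closedBall (0 : ℂ) 1, 1 / 2 < (zetaExpr f ζ z).re := by
    intro f hf z hz
    rcases eq_or_ne z 0 with rfl | hz0
    · refine ⟨fun ζ hζ => ?_, ?_, fun ζ hζ => ?_⟩
      · rw [hf.zetaDeriv_zero hζ]; exact one_ne_zero
      · exact (continuousOn_const (c := (1 : ℂ))).congr fun ζ hζ => hf.zetaExpr_zero hζ
      · rw [hf.zetaExpr_zero hζ]; norm_num
    · refine ⟨fun ζ hζ => ?_, ?_, fun ζ hζ => hf.half_lt_re_zetaExpr hz hz0 hζ⟩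
      · rw [zetaDeriv_eq hf.differentiableOn hz hz0 hζ]
        exact div_ne_zero (hf.zetaSlope_ne_zero hz hz0 hζ) hz0
      · exact (hf.differentiableOn_dslope_div hz hz0).continuousOn.congr fun ζ hζ =>
          zetaExpr_eq hf.differentiableOn hz hz0 hζ (hf.zetaSlope_ne_zero hz hz0 hζ)
  refine ⟨main, isConvexUnivalent_div_one_sub, fun ζ hζ => ?_⟩
  have himage : (fun z => zetaExpr (fun z => z / (1 - z)) ζ z) '' ball (0 : ℂ) 1 =
      {w : ℂ | 1 / 2 < w.re} := by
    rw [← image_one_div_one_sub]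
    exact image_congr fun z hz => zetaExpr_div_one_sub hζ hz
  refine ⟨fun z hz => zetaExpr_div_one_sub hζ hz, himage, ?_, fun b hb => ?_⟩
  · rintro x ⟨f, hf, z, hz, rfl⟩
    exact ((main f hf z hz).2.2 ζ hζ).le
  -- Every real `x > 1/2` lies in the image half-plane, so it is a value attained by the extremal
  -- function.
  · refine le_of_forall_gt_imp_ge_of_dense fun x hx => ?_
    have hx' : (x : ℂ) ∈ {w : ℂ | 1 / 2 < w.re} := by simpa using hx
    rw [← himage] at hx'
    obtain ⟨z, hz, hzx⟩ := hx'
    refine hb ⟨_, isConvexUnivalent_div_one_sub, z, hz, ?_⟩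
    simp only at hzx
    rw [hzx, Complex.ofReal_re]
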